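/- Let $\{G_n\}_{n\in\mathbb N}$ be a sequence of finite groups, and let $S_n\subseteq G_n$ be generating sets such that $\sharp S_n\le L$ for all $n$, for some constant $L>0$. Equip $G_n$ with the word length metric $d_n(g,h)=\ell_{S_n}(g^{-1}h)$, where $\ell_{S_n}(g)$ is the least $k$ such that $g$ is a product of $k$ elements of $S_n\cup S_n^{-1}$. Let $X$ be a coarse disjoint union of the $(G_n,d_n)$, i.e. $X=\bigsqcup_n G_n$ with any metric $d$ that restricts to $d_n$ on each $G_n$ and satisfies $d(G_n,G_m)\ge n+m+\mathrm{diam}(G_n)+\mathrm{diam}(G_m)$ for all $n\ne m$. For a group $G$, let $\ell^2(G)_{1,+}$ be the set of functions $f\in\ell^2(G)$ with $\|f\|_2=1$ and $f(x)\ge 0$ for all $x\in G$; for $s\in G$ put $(s\cdot f)(h)=f(hs)$ and $(s\star f)(h)=f(s^{-1}h)$. For a function $f$ on a finite group $G$, let $T_f$ be the linear operator on $\ell^2(G)$ given by $(T_fh)(x)=\sum_{y\in G}K_f(x,y)h(y)$, where $K_f(x,y)=\langle x\star f,\,y\star f\rangle_{\ell^2(G)}$. Then the following are equivalent: 1. For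 any $\varepsilon>0$ there exist $M>0$ and functions $f_n\in\ell^2(G_n)_{1,+}$ $(n\in\mathbb N)$ such that, for all $n$, $\|f_n-s\cdot f_n\|_2\le\varepsilon$ for all $s\in S_n$, and $\|f_n\|_1\le M$. 2. For any $\varepsilon>0$ there exist $M'>0$ and functions $f_n\in\ell^2(G_n)_{1,+}$ $(n\in\mathbb N)$ such that, for all $n$, $\|f_n-s\cdot f_n\|_2\le\varepsilon$ for all $s\in S_n$, and the operator norm of $T_{f_n}$ is at most $M'$. 3. For any $\varepsilon>0$ there exist $N>0$ and functions $f_n\in\ell^2(G_n)_{1,+}$ $(n\in\mathbb N)$ such that, for all $n$, $\|f_n-s\cdot f_n\|_2\le\varepsilon$ for all $s\in S_n$, and $\sharp\,\mathrm{supp}(f_n)\le N$. 4. The sequence $\{(G_n,S_n)\}_n$ is uniformly amenable: for any $\varepsilon>0$ there exist $D>0$ and functions $f_n\in\ell^2(G_n)_{1,+}$ $(n\in\mathbb N)$ such that, for all $n$, $\|f_n-s\cdot f_n\|_2\le\varepsilon$ for all $s\in S_n$, and $\mathrm{supp}(f_n)$ is contained in the closed ball $B(1_{G_n},D)$. 5.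 $X$ has Property A: for any $\varepsilon,R>0$ there exist finite non-empty subsets $A_x\subseteq X\times\mathbb N$ $(x\in X)$ and a constant $C>0$ such that $A_x\subseteq B(x,C)\times\mathbb N$ for all $x\in X$, and $A_x\cap A_y\ne\emptyset$ and $\sharp(A_x\,\triangle\,A_y)/\sharp(A_x\cap A_y)\le\varepsilon$ whenever $d(x,y)\le R$. -/

import Mathlib

open scoped ComplexOrder symmDiff

/-- The `ℓ^p`-norm `(∑ |f x|^p)^(1/p)` of a complex-valued function, used for real `1 ≤ p < ∞` and
functions that are `p`-summable. -/
noncomputable def ellNorm {X : Type*} (p : ℝ) (f : X → ℂ) : ℝ :=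
  (∑' x, ‖f x‖ ^ p) ^ (1 / p)

/-- `ℓ^p(X)_{1,+}`: the pointwise non-negative functions in `ℓ^p(X)` of `ℓ^p`-norm one. -/
def ellUnitNonneg (p : ℝ) (X : Type*) : Set (X → ℂ) :=
  {f | Summable (fun x => ‖f x‖ ^ p) ∧ ellNorm p f = 1 ∧ ∀ x, 0 ≤ f x}

/-- The right `γ`-translation `(γ · f)(h) = f(hγ)`. -/
def rightTranslate {G : Type*} [Group G] (γ : G) (f : G → ℂ) : G → ℂ :=
  fun h => f (h * γ)

/-- The left `γ`-translation `(γ ⋆ f)(h) = f(γ⁻¹h)`. -/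
def leftTranslate {G : Type*} [Group G] (γ : G) (f : G → ℂ) : G → ℂ :=
  fun h => f (γ⁻¹ * h)

/-- The word length: the least `k` such that `g` is a product of `k` elements of `S ∪ S⁻¹`. -/
noncomputable def wordLength {G : Type*} [Group G] (S : Set G) (g : G) : ℕ :=
  sInf {k : ℕ | ∃ w : List G, w.length = k ∧ (∀ a ∈ w, a ∈ S ∨ a⁻¹ ∈ S) ∧ w.prod = g}

/-- The word length distance `d_S(g, h) = ℓ_S(g⁻¹h)`. -/
noncomputable def wordDist {G : Type*} [Group G] (S : Set G) (g h : G) : ℝ :=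
  (wordLength S (g⁻¹ * h) : ℝ)

theorem wordLength_le {G : Type*} [Group G] {S : Set G} (w : List G)
    (hw : ∀ a ∈ w, a ∈ S ∨ a⁻¹ ∈ S) : wordLength S w.prod ≤ w.length :=
  Nat.sInf_le ⟨w, rfl, hw, rfl⟩

theorem exists_word {G : Type*} [Group G] {S : Set G} (hS : Subgroup.closure S = ⊤) (g : G) :
    ∃ w : List G, w.length = wordLength S g ∧ (∀ a ∈ w, a ∈ S ∨ a⁻¹ ∈ S) ∧ w.prod = g := by
  have hg : g ∈ (Subgroup.closure S).toSubmonoid := by rw [hS]; exact Subgroup.mem_top g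
  rw [Subgroup.closure_toSubmonoid] at hg
  obtain ⟨w, hw, hp⟩ := Submonoid.exists_list_of_mem_closure hg
  exact Nat.sInf_mem (s := {k : ℕ | ∃ w : List G,
    w.length = k ∧ (∀ a ∈ w, a ∈ S ∨ a⁻¹ ∈ S) ∧ w.prod = g}) ⟨w.length, w, rfl, hw, hp⟩

theorem wordLength_one {G : Type*} [Group G] (S : Set G) : wordLength S (1 : G) = 0 := by
  have h := wordLength_le (S := S) ([] : List G) (by simp)
  simpa using h

theorem wordLength_mul_le {G : Type*} [Group G] {S : Set G} (hS : Subgroup.closure S = ⊤)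
    (g h : G) : wordLength S (g * h) ≤ wordLength S g + wordLength S h := by
  obtain ⟨v, hv, hvS, rfl⟩ := exists_word hS g
  obtain ⟨w, hw, hwS, rfl⟩ := exists_word hS h
  rw [← hv, ← hw, ← List.prod_append, ← List.length_append]
  apply wordLength_le
  intro a ha
  rcases List.mem_append.1 ha with ha | ha
  exacts [hvS a ha, hwS a ha]

theorem wordLength_inv_le {G : Type*} [Group G] {S : Set G} (hS : Subgroup.closure S = ⊤)
    (g : G) : wordLength S g⁻¹ ≤ wordLength S g := by
  obtain ⟨w, hw, hwS, rfl⟩ := exists_word hS g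
  rw [← hw, List.prod_inv_reverse]
  refine (wordLength_le _ ?_).trans (by simp)
  intro a ha
  simp only [List.mem_reverse, List.mem_map] at ha
  obtain ⟨b, hb, rfl⟩ := ha
  simpa [or_comm] using hwS b hb

/-- The word length metric on `G` associated to a generating set `S`. -/
@[reducible]
noncomputable def wordMetricSpace {G : Type*} [Group G] (S : Set G)
    (hS : Subgroup.closure S = ⊤) : MetricSpace G where
  dist := wordDist S
  dist_self g := by simp [wordDist, wordLength_one]
  dist_comm g h := by
    have key : ∀ a b : G, wordLength S (a⁻¹ * b) ≤ wordLength S (b⁻¹ * a) := fun a b => by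
      simpa using wordLength_inv_le hS (b⁻¹ * a)
    simp only [wordDist]
    exact_mod_cast le_antisymm (key g h) (key h g)
  dist_triangle g h k := by
    have := wordLength_mul_le hS (g⁻¹ * h) (h⁻¹ * k)
    simp only [wordDist]
    rw [show g⁻¹ * h * (h⁻¹ * k) = g⁻¹ * k by group] at this
    exact_mod_cast this
  eq_of_dist_eq_zero {g h} hgh := by
    have h0 : wordLength S (g⁻¹ * h) = 0 := Nat.cast_injective (R := ℝ) (hgh.trans Nat.cast_zero.symm)
    obtain ⟨w, hw, -, hp⟩ := exists_word hS (g⁻¹ * h)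
    rw [h0, List.length_eq_zero_iff] at hw
    subst hw
    exact inv_mul_eq_one.1 hp.symm

/-- The metric `D` on the disjoint union of the `X_n` makes it a coarse disjoint union of the (finite)
metric spaces `(X_n, d_n)`: it restricts to `d_n` on `X_n`, and
`d(X_n, X_m) ≥ n + m + diam X_n + diam X_m` for `n ≠ m`. -/
def IsCoarseDisjointUnion {X : ℕ → Type*} (d : ∀ n, MetricSpace (X n))
    (D : MetricSpace (Σ n, X n)) : Prop :=
  (∀ (n : ℕ) (x y : X n), D.dist ⟨n, x⟩ ⟨n, y⟩ = (d n).dist x y) ∧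
  ∀ n m : ℕ, n ≠ m → ∀ (x : X n) (y : X m),
    (n : ℝ) + m + @Metric.diam (X n) (d n).toPseudoMetricSpace Set.univ
      + @Metric.diam (X m) (d m).toPseudoMetricSpace Set.univ ≤ D.dist ⟨n, x⟩ ⟨m, y⟩

/-- Yu's Property A. The ratio is only meaningful when the intersection is non-empty, so this is
part of the condition (the case `x = y` says that every `A x` is non-empty). -/
def PropertyA (X : Type*) [MetricSpace X] : Prop :=
  ∀ ε > (0 : ℝ), ∀ R > (0 : ℝ), ∃ (A : X → Set (X × ℕ)) (S : ℝ), 0 < S ∧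
    (∀ x, (A x).Finite) ∧
    (∀ x y, dist x y ≤ R → (A x ∩ A y).Nonempty ∧
      ((A x ∆ A y).ncard : ℝ) / ((A x ∩ A y).ncard : ℝ) ≤ ε) ∧
    ∀ x, A x ⊆ Metric.closedBall x S ×ˢ Set.univ

/-- Uniform amenability of a family of groups with generating sets. -/
def UniformlyAmenable {I : Type*} (G : I → Type*) [∀ i, Group (G i)]
    (S : ∀ i, Set (G i)) : Prop :=
  ∀ ε > (0 : ℝ), ∃ D > (0 : ℝ), ∃ f : ∀ i, G i → ℂ, ∀ i,
    f i ∈ ellUnitNonneg 2 (G i) ∧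
    (∀ s ∈ S i, ellNorm 2 (f i - rightTranslate s (f i)) ≤ ε) ∧
    Function.support (f i) ⊆ {g | wordDist (S i) 1 g ≤ D}

/-- The associated kernel `K_f(x, y) = ⟨x ⋆ f, y ⋆ f⟩` of a function on a finite group, with the
inner product `⟨u, v⟩ = ∑ u(z) conj(v(z))` of `ℓ²(G)`. -/
noncomputable def associatedKernel {G : Type*} [Group G] [Fintype G] (f : G → ℂ) :
    Matrix G G ℂ :=
  Matrix.of fun x y => ∑ z, leftTranslate x f z * star (leftTranslate y f z)

open Classical in
/-- The associated operator `T_f` on `ℓ²(G)` of a function on a finite group,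
`(T_f h)(γ) = ∑ γ', K_f(γ, γ') h(γ')`; its norm `‖associatedOperator f‖` is the operator norm. -/
noncomputable def associatedOperator {G : Type*} [Group G] [Fintype G] (f : G → ℂ) :
    EuclideanSpace ℂ G →L[ℂ] EuclideanSpace ℂ G :=
  Matrix.toEuclideanCLM (n := G) (𝕜 := ℂ) (associatedKernel f)

/-! Any complex function allowed in the conditions is real, so everything is phrased with
`AlmostInvariant` vectors $a$; the conditions differ only in how they control the size of $a$.

The kernel of $T_a$ is non-negative and all its row and column sums equal $\|a\|_1^2$, so
$\|T_a\|=\|a\|_1^2$ and conditions 1 and 2 agree. An $\ell^1$-bound becomes a support bound by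
discarding small values (`AlmostInvariant.exists_ncard_support_le`); conversely the values of a unit
vector are at most 1, so its $\ell^1$-norm is at most the size of its support.

Few support points may still lie far apart. Splitting $a$ along the components of its support in the
Cayley graph splits both the norm and the displacement additively, so some component has small
relative displacement. Its diameter is less than its number of points, and a left translation moves
it to the identity (`AlmostInvariant.exists_support_subset`). Conversely, balls have bounded size
because $\sharp S_n\le L$.

For Property A, the densities $z\mapsto a(z^{-1}x)^2$ vary slowly in $x$ and are rounded to finite
sets, the factor $\mathbb N$ recording multiplicity. In the other direction, the sets $A_x$ give
densities on each $G_n$, and averaging them over left translations makes them equivariant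
(`exists_almostInvariant_of_density`). -/

/-- A non-negative unit vector of `ℓ²(G)` moved by at most `ε` by right translation by `S`. -/
structure AlmostInvariant {G : Type*} [Group G] [Fintype G] (S : Set G) (ε : ℝ) (a : G → ℝ) :
    Prop where
  nonneg : ∀ x, 0 ≤ a x
  sum_sq : ∑ x, a x ^ 2 = 1
  sum_sq_sub_le : ∀ s ∈ S, ∑ x, (a x - a (x * s)) ^ 2 ≤ ε ^ 2

/-! ### Translation between complex norms and real sums. -/

section Norms

variable {G : Type*} [Fintype G]

theorem ellNorm_two_eq_sqrt (f : G → ℂ) : ellNorm 2 f = √(∑ x, ‖f x‖ ^ 2) := by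
  simp [ellNorm, tsum_fintype, Real.sqrt_eq_rpow]

theorem ellNorm_one_ofReal {a : G → ℝ} (ha : ∀ x, 0 ≤ a x) :
    ellNorm 1 (fun x => (a x : ℂ)) = ∑ x, a x := by
  simp [ellNorm, tsum_fintype, abs_of_nonneg (ha _)]

theorem ofReal_mem_ellUnitNonneg_two_iff (a : G → ℝ) :
    (fun x => (a x : ℂ)) ∈ ellUnitNonneg 2 G ↔ ∑ x, a x ^ 2 = 1 ∧ ∀ x, 0 ≤ a x := by
  simp [ellUnitNonneg, ellNorm_two_eq_sqrt, Real.sqrt_eq_one, Summable.of_finite]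

theorem ellNorm_two_sub_rightTranslate_le_iff [Group G] (a : G → ℝ) (s : G) {ε : ℝ} (hε : 0 < ε) :
    ellNorm 2 ((fun x => (a x : ℂ)) - rightTranslate s (fun x => (a x : ℂ))) ≤ ε ↔
      ∑ x, (a x - a (x * s)) ^ 2 ≤ ε ^ 2 := by
  rw [ellNorm_two_eq_sqrt, Real.sqrt_le_left hε.le]
  have : ∀ x, ‖((fun x => (a x : ℂ)) - rightTranslate s (fun x => (a x : ℂ))) x‖ ^ 2 =
      (a x - a (x * s)) ^ 2 := fun x => by
    simp only [Pi.sub_apply, rightTranslate]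
    rw [← Complex.ofReal_sub, Complex.norm_real, Real.norm_eq_abs, sq_abs]
  simp_rw [this]

end Norms

theorem almostInvariant_iff {G : Type*} [Group G] [Fintype G] {S : Set G} {ε : ℝ} (hε : 0 < ε)
    (a : G → ℝ) :
    AlmostInvariant S ε a ↔ (fun x => (a x : ℂ)) ∈ ellUnitNonneg 2 G ∧
      ∀ s ∈ S, ellNorm 2 ((fun x => (a x : ℂ)) - rightTranslate s (fun x => (a x : ℂ))) ≤ ε := by
  simp only [ofReal_mem_ellUnitNonneg_two_iff, ellNorm_two_sub_rightTranslate_le_iff _ _ hε]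
  exact ⟨fun h => ⟨⟨h.2, h.1⟩, h.3⟩, fun h => ⟨h.1.2, h.1.1, h.2⟩⟩

/-- Families of almost invariant complex functions may be replaced by families of real ones. -/
theorem exists_almostInvariant_iff {I : Type*} {G : I → Type*} [∀ i, Group (G i)]
    [∀ i, Fintype (G i)] {S : ∀ i, Set (G i)} {ε : ℝ} (hε : 0 < ε)
    (P : ∀ i, (G i → ℂ) → Prop) :
    (∃ f : ∀ i, G i → ℂ, ∀ i, f i ∈ ellUnitNonneg 2 (G i) ∧
      (∀ s ∈ S i, ellNorm 2 (f i - rightTranslate s (f i)) ≤ ε) ∧ P i (f i)) ↔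
    ∃ a : ∀ i, G i → ℝ, ∀ i, AlmostInvariant (S i) ε (a i) ∧ P i (fun x => (a i x : ℂ)) := by
  simp_rw [almostInvariant_iff hε]
  constructor
  · rintro ⟨f, hf⟩
    have key : ∀ i, (fun x => ((f i x).re : ℂ)) = f i := fun i => by
      funext x
      exact (Complex.eq_re_of_ofReal_le (r := 0) (by simpa using (hf i).1.2.2 x)).symm
    refine ⟨fun i x => (f i x).re, fun i => ?_⟩
    rw [key]
    exact ⟨⟨(hf i).1, (hf i).2.1⟩, (hf i).2.2⟩
  · rintro ⟨a, ha⟩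
    exact ⟨fun i x => a i x, fun i => ⟨(ha i).1.1, (ha i).1.2, (ha i).2⟩⟩

/-! ### Operator norm, $\ell^1$-norm and size of the support. -/

section Group

variable {G : Type*} [Group G] [Fintype G] {S : Set G} {ε : ℝ}

/-- Normalising a non-negative vector with small relative displacement. -/
theorem AlmostInvariant.normalize {u : G → ℝ} (hu : ∀ x, 0 ≤ u x) (hpos : 0 < ∑ x, u x ^ 2)
    (hS : ∀ s ∈ S, ∑ x, (u x - u (x * s)) ^ 2 ≤ ε ^ 2 * ∑ x, u x ^ 2) :
    AlmostInvariant S ε (fun x => u x / √(∑ x, u x ^ 2)) where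
  nonneg x := div_nonneg (hu x) (Real.sqrt_nonneg _)
  sum_sq := by
    simp_rw [div_pow, Real.sq_sqrt hpos.le]
    rw [← Finset.sum_div, div_self hpos.ne']
  sum_sq_sub_le s hs := by
    simp_rw [← sub_div, div_pow, Real.sq_sqrt hpos.le]
    rw [← Finset.sum_div, div_le_iff₀ hpos]
    exact hS s hs

theorem AlmostInvariant.const (S : Set G) (ε : ℝ) :
    AlmostInvariant S ε (fun _ : G => 1 / √(∑ _ : G, (1 : ℝ) ^ 2)) :=
  AlmostInvariant.normalize (u := fun _ => 1) (fun _ => zero_le_one)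
    (by simp [Fintype.card_pos]) (fun s _ => by simp; positivity)

theorem associatedKernel_ofReal (a : G → ℝ) (x y : G) :
    associatedKernel (fun x => (a x : ℂ)) x y = ((∑ z, a (x⁻¹ * z) * a (y⁻¹ * z) : ℝ) : ℂ) := by
  simp [associatedKernel, leftTranslate]

theorem sum_translate_mul (a : G → ℝ) (x : G) :
    ∑ y, ∑ z, a (x⁻¹ * z) * a (y⁻¹ * z) = (∑ x, a x) ^ 2 := by
  rw [Finset.sum_comm]
  have h : ∀ z, ∑ y, a (y⁻¹ * z) = ∑ y, a y := fun z =>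
    Equiv.sum_comp ((Equiv.inv G).trans (Equiv.mulRight z)) a
  simp_rw [← Finset.mul_sum, h, ← Finset.sum_mul]
  have h' : ∑ z, a (x⁻¹ * z) = ∑ z, a z := Equiv.sum_comp (Equiv.mulLeft x⁻¹) a
  rw [h', sq]

theorem associatedOperator_apply (f : G → ℂ) (v : EuclideanSpace ℂ G) (x : G) :
    associatedOperator f v x = ∑ y, associatedKernel f x y * v y := by
  classical
  simp only [associatedOperator]
  exact congrFun (Matrix.ofLp_toEuclideanCLM (n := G) (𝕜 := ℂ) (associatedKernel f) v) x

/-- Upper bound: the Schur test for a non-negative symmetric kernel with constant row sums. It is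
attained, since the constant function is an eigenvector with that row sum as eigenvalue. -/
theorem norm_associatedOperator_ofReal {a : G → ℝ} (ha : ∀ x, 0 ≤ a x) :
    ‖associatedOperator (fun x => (a x : ℂ))‖ = (∑ x, a x) ^ 2 := by
  set c := (∑ x, a x) ^ 2 with hc
  have hc0 : 0 ≤ c := sq_nonneg _
  set k : G → G → ℝ := fun x y => ∑ z, a (x⁻¹ * z) * a (y⁻¹ * z) with hk
  have hk0 : ∀ x y, 0 ≤ k x y := fun x y =>
    Finset.sum_nonneg fun z _ => mul_nonneg (ha _) (ha _)
  have hksymm : ∀ x y, k x y = k y x := fun x y => by simp_rw [hk, mul_comm]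
  have hrow : ∀ x, ∑ y, k x y = c := fun x => sum_translate_mul a x
  have hcol : ∀ y, ∑ x, k x y = c := fun y => by simp_rw [fun x => hksymm x y, hrow]
  have happ : ∀ v x, associatedOperator (fun x => (a x : ℂ)) v x = ∑ y, (k x y : ℂ) * v y :=
    fun v x => by simp_rw [associatedOperator_apply, associatedKernel_ofReal, hk]
  apply le_antisymm
  · refine ContinuousLinearMap.opNorm_le_bound _ hc0 fun v => ?_
    refine le_of_sq_le_sq ?_ (by positivity)
    rw [mul_pow, EuclideanSpace.norm_sq_eq, EuclideanSpace.norm_sq_eq]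
    calc ∑ x, ‖associatedOperator (fun x => (a x : ℂ)) v x‖ ^ 2
        ≤ ∑ x, c * ∑ y, k x y * ‖v y‖ ^ 2 := by
          refine Finset.sum_le_sum fun x _ => ?_
          rw [happ, ← hrow x]
          calc ‖∑ y, (k x y : ℂ) * v y‖ ^ 2 ≤ (∑ y, k x y * ‖v y‖) ^ 2 := by
                gcongr
                refine (norm_sum_le _ _).trans_eq (Finset.sum_congr rfl fun y _ => ?_)
                rw [norm_mul, Complex.norm_real, Real.norm_of_nonneg (hk0 x y)]
            _ ≤ (∑ y, k x y) * ∑ y, k x y * ‖v y‖ ^ 2 :=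
                Finset.sum_sq_le_sum_mul_sum_of_sq_le_mul _ (fun y _ => hk0 x y)
                  (fun y _ => mul_nonneg (hk0 x y) (sq_nonneg _)) (fun y _ => by ring_nf; rfl)
      _ = c ^ 2 * ∑ y, ‖v y‖ ^ 2 := by
          rw [← Finset.mul_sum, Finset.sum_comm]
          simp_rw [← Finset.sum_mul, hcol, ← Finset.mul_sum]
          ring
  · set v : EuclideanSpace ℂ G := WithLp.toLp 2 fun _ => 1 with hv
    have hTv : associatedOperator (fun x => (a x : ℂ)) v = (c : ℂ) • v := by
      ext x
      rw [happ]
      simp [hv, ← hrow x]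
    have hv0 : 0 < ‖v‖ := norm_pos_iff.2 fun h => one_ne_zero (congrArg (fun w => w 1) h : (1 : ℂ) = 0)
    have := (associatedOperator (fun x => (a x : ℂ))).le_opNorm v
    rw [hTv, norm_smul, Complex.norm_real, Real.norm_of_nonneg hc0] at this
    exact le_of_mul_le_mul_right this hv0

/-- Truncating an almost invariant vector with small `ℓ¹`-norm gives small support. -/
theorem AlmostInvariant.exists_ncard_support_le {a : G → ℝ} {M δ : ℝ}
    (ha : AlmostInvariant S (ε / 4) a) (hM : ∑ x, a x ≤ M) (hδ : 0 < δ)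
    (h1 : δ * M ≤ 1 / 2) (h2 : δ * M ≤ ε ^ 2 / 24) :
    ∃ b, AlmostInvariant S ε b ∧ ((Function.support b).ncard : ℝ) ≤ M / δ := by
  classical
  set u : G → ℝ := fun x => if δ ≤ a x then a x else 0 with hu
  set v : G → ℝ := fun x => if δ ≤ a x then 0 else a x with hv
  -- The discarded part satisfies $v^2\le\delta a$ pointwise, hence has squared norm at most $\delta
  -- M$; as `u` and `v` have disjoint supports, `u` keeps at least half of the mass.
  have huv : ∀ x, a x = u x + v x := fun x => by simp only [hu, hv]; split_ifs <;> simp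
  have hv2 : ∑ x, v x ^ 2 ≤ δ * M := by
    refine le_trans ?_ (mul_le_mul_of_nonneg_left hM hδ.le)
    rw [Finset.mul_sum]
    refine Finset.sum_le_sum fun x _ => ?_
    have := ha.nonneg x
    simp only [hv]
    split_ifs with h <;> nlinarith
  have hu2 : 1 - δ * M ≤ ∑ x, u x ^ 2 := by
    have : ∑ x, a x ^ 2 = ∑ x, u x ^ 2 + ∑ x, v x ^ 2 := by
      rw [← Finset.sum_add_distrib]
      refine Finset.sum_congr rfl fun x _ => ?_
      simp only [hu, hv]; split_ifs <;> simp
    linarith [ha.sum_sq]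
  refine ⟨_, AlmostInvariant.normalize (u := u) (fun x => ?_) (by linarith) (fun s hs => ?_), ?_⟩
  · simp only [hu]; split_ifs; exacts [ha.nonneg x, le_rfl]
  · have hvs : ∑ x, v (x * s) ^ 2 = ∑ x, v x ^ 2 :=
      Equiv.sum_comp (Equiv.mulRight s) (fun x => v x ^ 2)
    have : ∑ x, (u x - u (x * s)) ^ 2 ≤
        ∑ x, (3 * (a x - a (x * s)) ^ 2 + 3 * v x ^ 2 + 3 * v (x * s) ^ 2) := by
      refine Finset.sum_le_sum fun x _ => ?_
      rw [huv x, huv (x * s)]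
      nlinarith [sq_nonneg ((u x + v x - (u (x * s) + v (x * s))) + v x),
        sq_nonneg ((u x + v x - (u (x * s) + v (x * s))) - v (x * s)),
        sq_nonneg (v x + v (x * s))]
    rw [Finset.sum_add_distrib, Finset.sum_add_distrib, ← Finset.mul_sum, ← Finset.mul_sum,
      ← Finset.mul_sum, hvs] at this
    have h3 := ha.sum_sq_sub_le s hs
    -- The displacement is at most $3(\varepsilon/4)^2+6\delta M\le\frac{7}{16}\varepsilon^2$, which
    -- is below $\varepsilon^2\sum u^2$ because $\sum u^2\ge\frac12$.
    nlinarith [sq_nonneg ε]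
  · rw [le_div_iff₀ hδ]
    refine le_trans ?_ hM
    set T := Finset.univ.filter fun x => δ ≤ a x with hT
    have hsub : Function.support (fun x => u x / √(∑ x, u x ^ 2)) ⊆ (T : Set G) := by
      intro x hx
      by_contra h
      have h : ¬ δ ≤ a x := by simpa [hT] using h
      exact hx (by simp [hu, h])
    calc _ ≤ (T.card : ℝ) * δ := by
          gcongr
          rw [← Set.ncard_coe_finset]
          exact Set.ncard_le_ncard hsub (Set.toFinite _)
      _ = ∑ x ∈ T, δ := by simp
      _ ≤ ∑ x ∈ T, a x := Finset.sum_le_sum fun x hx => (Finset.mem_filter.1 hx).2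
      _ ≤ ∑ x, a x := Finset.sum_le_univ_sum_of_nonneg ha.nonneg

theorem AlmostInvariant.sum_le {a : G → ℝ} (ha : AlmostInvariant S ε a) {N : ℕ}
    (hN : (Function.support a).ncard ≤ N) : ∑ x, a x ≤ N := by
  classical
  have hle : ∀ x, a x ≤ 1 := fun x => by
    have : a x ^ 2 ≤ 1 := ha.sum_sq ▸
      Finset.single_le_sum (f := fun x => a x ^ 2) (fun y _ => sq_nonneg _) (Finset.mem_univ x)
    exact (sq_le_one_iff₀ (ha.nonneg x)).1 this
  rw [← Finset.sum_filter_ne_zero]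
  calc _ ≤ ∑ x ∈ Finset.univ.filter (fun x => a x ≠ 0), (1 : ℝ) :=
        Finset.sum_le_sum fun x _ => hle x
    _ = ((Function.support a).ncard : ℝ) := by
        rw [Set.ncard_eq_toFinset_card', Finset.sum_const, nsmul_one]
        congr 2
        ext x
        simp
    _ ≤ N := by exact_mod_cast hN

end Group

/-! ### Word balls and connected components of the support. -/

section Words

variable {G : Type*} [Group G]

theorem wordLength_le_one {S : Set G} {s : G} (hs : s ∈ S ∨ s⁻¹ ∈ S) : wordLength S s ≤ 1 := by
  simpa using wordLength_le [s] (by simpa using hs)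

theorem wordDist_one_left (S : Set G) (g : G) : wordDist S 1 g = wordLength S g := by
  simp [wordDist]

open scoped Pointwise in
/-- Balls in a group with `L` generators have at most `(2L+1)^k` elements. -/
theorem ncard_wordLength_le {S : Finset G} (hS : Subgroup.closure (S : Set G) = ⊤) {L : ℕ}
    (hL : S.card ≤ L) (k : ℕ) :
    {g : G | wordLength (S : Set G) g ≤ k}.ncard ≤ (2 * L + 1) ^ k := by
  classical
  -- Including 1 makes the powers of `T` increasing, so words of length at most `k` all land in `T ^
  -- k`.
  set T : Finset G := insert 1 (S ∪ S⁻¹) with hT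
  have hcard : T.card ≤ 2 * L + 1 := by
    refine (Finset.card_insert_le _ _).trans ?_
    have := Finset.card_union_le S S⁻¹
    rw [Finset.card_inv] at this
    omega
  have hprod : ∀ w : List G, (∀ a ∈ w, a ∈ S ∨ a⁻¹ ∈ S) → w.prod ∈ T ^ w.length := by
    intro w
    induction w with
    | nil => simp
    | cons b w ih =>
      intro hw
      rw [List.prod_cons, List.length_cons, pow_succ']
      refine Finset.mul_mem_mul ?_ (ih fun c hc => hw c (List.mem_cons_of_mem _ hc))
      simpa [hT] using Or.inr (hw b (by simp))
  have hsub : {g : G | wordLength (S : Set G) g ≤ k} ⊆ (T ^ k : Finset G) := by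
    intro g hg
    obtain ⟨w, hw, hwS, rfl⟩ := exists_word hS g
    have := hprod w (by simpa using hwS)
    exact Finset.mem_coe.2 (Finset.pow_subset_pow_right (by simp [hT]) (hw.trans_le hg) this)
  calc _ ≤ (T ^ k).card := by
        rw [← Set.ncard_coe_finset]
        exact Set.ncard_le_ncard hsub (Finset.finite_toSet _)
    _ ≤ T.card ^ k := Finset.card_pow_le
    _ ≤ _ := Nat.pow_le_pow_left hcard k

/-- The graph on the support of `a` with edges between `h` and `hs` for `s ∈ S`. -/
def supportGraph (S : Set G) (a : G → ℝ) : SimpleGraph G :=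
  SimpleGraph.fromRel fun h k => a h ≠ 0 ∧ a k ≠ 0 ∧ h⁻¹ * k ∈ S

variable {S : Set G} {a : G → ℝ}

theorem supportGraph_adj {h k : G} : (supportGraph S a).Adj h k ↔
    h ≠ k ∧ (a h ≠ 0 ∧ a k ≠ 0 ∧ h⁻¹ * k ∈ S ∨ a k ≠ 0 ∧ a h ≠ 0 ∧ k⁻¹ * h ∈ S) :=
  SimpleGraph.fromRel_adj _ _ _

theorem wordLength_le_walk_length (hS : Subgroup.closure S = ⊤) {h k : G}
    (p : (supportGraph S a).Walk h k) : wordLength S (h⁻¹ * k) ≤ p.length := by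
  induction p with
  | nil => simp [wordLength_one]
  | @cons u v w huv p ih =>
    have h1 : wordLength S (u⁻¹ * v) ≤ 1 := wordLength_le_one <| by
      rcases (supportGraph_adj.1 huv).2 with h | h
      exacts [Or.inl h.2.2, Or.inr (by simpa using h.2.2)]
    have := wordLength_mul_le hS (u⁻¹ * v) (v⁻¹ * w)
    rw [show u⁻¹ * v * (v⁻¹ * w) = u⁻¹ * w by group] at this
    rw [SimpleGraph.Walk.length_cons]
    omega

theorem ne_zero_of_mem_walk_support {h k : G} (p : (supportGraph S a).Walk h k) (hh : a h ≠ 0) :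
    ∀ x ∈ p.support, a x ≠ 0 := by
  induction p with
  | nil => simpa using hh
  | @cons u v w huv p ih =>
    have hv : a v ≠ 0 := by
      rcases (supportGraph_adj.1 huv).2 with h | h
      exacts [h.2.1, h.1]
    intro x hx
    rw [SimpleGraph.Walk.support_cons, List.mem_cons] at hx
    rcases hx with rfl | hx
    exacts [hh, ih hv x hx]

/-- A simple path visits distinct points of the support, so its length is less than the number of
these points. -/
theorem wordLength_le_of_reachable [Finite G] (hS : Subgroup.closure S = ⊤) {h k : G}
    (hhk : (supportGraph S a).Reachable h k) (hh : a h ≠ 0) :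
    wordLength S (h⁻¹ * k) ≤ (Function.support a).ncard := by
  classical
  obtain ⟨p, hp⟩ := hhk.exists_isPath
  refine (wordLength_le_walk_length hS p).trans ?_
  have h1 : p.support.toFinset.card = p.length + 1 := by
    rw [List.toFinset_card_of_nodup hp.support_nodup, SimpleGraph.Walk.length_support]
  have h2 : p.support.toFinset.card ≤ (Function.support a).ncard := by
    rw [← Set.ncard_coe_finset]
    refine Set.ncard_le_ncard (fun x hx => ?_) (Set.toFinite _)
    exact ne_zero_of_mem_walk_support p hh x (by simpa using hx)
  omega

end Words

/-- An almost invariant vector with small support can be localised on a connected component of its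
support, which is contained in a ball. -/
theorem AlmostInvariant.exists_support_subset {G : Type*} [Group G] [Fintype G] {S : Finset G}
    (hS : Subgroup.closure (S : Set G) = ⊤) {L : ℕ} (hL : S.card ≤ L) {ε' ε : ℝ}
    (hε : L * ε' ^ 2 ≤ ε ^ 2) {a : G → ℝ} (ha : AlmostInvariant (S : Set G) ε' a) :
    ∃ b, AlmostInvariant (S : Set G) ε b ∧
      ∀ g, b g ≠ 0 → wordLength (S : Set G) g ≤ (Function.support a).ncard := by
  classical
  set Γ := supportGraph (S : Set G) a with hΓ
  let u : Γ.ConnectedComponent → G → ℝ :=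
    fun c h => if Γ.connectedComponentMk h = c then a h else 0
  have husum : ∀ h, ∑ c, u c h ^ 2 = a h ^ 2 := fun h => by simp [u, ite_pow]
  have hud : ∀ s ∈ S, ∀ h, ∑ c, (u c h - u c (h * s)) ^ 2 = (a h - a (h * s)) ^ 2 := by
    intro s hs h
    -- If `h` and `h * s` both lie in the support, they are equal or adjacent, hence in one
    -- component; otherwise both sides vanish. This makes the displacements add up exactly.
    have hcross : ∑ c, u c h * u c (h * s) = a h * a (h * s) := by
      by_cases hc : Γ.connectedComponentMk h = Γ.connectedComponentMk (h * s)
      · simp [u, hc]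
      · have h0 : a h * a (h * s) = 0 := by
          by_contra hne
          obtain ⟨h1, h2⟩ := mul_ne_zero_iff.1 hne
          refine hc (SimpleGraph.ConnectedComponent.sound (SimpleGraph.Adj.reachable ?_))
          refine supportGraph_adj.2 ⟨fun h => hc (by rw [← h]), Or.inl ⟨h1, h2, by simpa using hs⟩⟩
        rw [h0]
        refine Finset.sum_eq_zero fun c _ => ?_
        simp only [u]
        split_ifs with h1 h2
        · exact absurd (h1.trans h2.symm) hc
        all_goals simp
    have : ∀ c, (u c h - u c (h * s)) ^ 2 =
        u c h ^ 2 + u c (h * s) ^ 2 - 2 * (u c h * u c (h * s)) := fun c => by ring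
    simp_rw [this]
    rw [Finset.sum_sub_distrib, Finset.sum_add_distrib, husum, husum, ← Finset.mul_sum, hcross]
    ring
  have htot : ∑ c, ∑ h, u c h ^ 2 = 1 := by
    rw [Finset.sum_comm]
    simp_rw [husum, ha.sum_sq]
  have htotd : ∑ c, ∑ s ∈ S, ∑ h, (u c h - u c (h * s)) ^ 2 ≤ ε ^ 2 := by
    rw [Finset.sum_comm]
    calc _ = ∑ s ∈ S, ∑ h, (a h - a (h * s)) ^ 2 :=
          Finset.sum_congr rfl fun s hs => by
            rw [Finset.sum_comm]
            exact Finset.sum_congr rfl fun h _ => hud s hs h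
      _ ≤ ∑ s ∈ S, ε' ^ 2 := Finset.sum_le_sum fun s hs => ha.sum_sq_sub_le s hs
      _ = S.card * ε' ^ 2 := by simp
      _ ≤ L * ε' ^ 2 := by gcongr
      _ ≤ ε ^ 2 := hε
  -- Averaging over components. The displacement is summed over all of `S` first, so that one
  -- component serves every generator; this costs the factor `L`.
  obtain ⟨c, hcpos, hc⟩ : ∃ c, 0 < ∑ h, u c h ^ 2 ∧
      ∑ s ∈ S, ∑ h, (u c h - u c (h * s)) ^ 2 ≤ ε ^ 2 * ∑ h, u c h ^ 2 := by
    by_contra! hcon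
    have hnn : ∀ c, 0 ≤ ∑ h, u c h ^ 2 := fun c => Finset.sum_nonneg fun h _ => sq_nonneg _
    obtain ⟨c, -, hc⟩ := Finset.exists_ne_zero_of_sum_ne_zero (htot.trans_ne one_ne_zero)
    have : ∑ c, ε ^ 2 * ∑ h, u c h ^ 2 <
        ∑ c, ∑ s ∈ S, ∑ h, (u c h - u c (h * s)) ^ 2 := by
      refine Finset.sum_lt_sum (fun c _ => ?_)
        ⟨c, Finset.mem_univ c, hcon c ((hnn c).lt_of_ne' hc)⟩
      rcases (hnn c).eq_or_lt with h | h
      · rw [← h, mul_zero]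
        exact Finset.sum_nonneg fun s _ => Finset.sum_nonneg fun h _ => sq_nonneg _
      · exact (hcon c h).le
    rw [← Finset.mul_sum, htot, mul_one] at this
    exact absurd htotd this.not_ge
  obtain ⟨h₀, -, hh₀⟩ := Finset.exists_ne_zero_of_sum_ne_zero hcpos.ne'
  have hh₀ : u c h₀ ≠ 0 := fun h => hh₀ (by simp [h])
  have hu : ∀ h, u c h ≠ 0 → Γ.connectedComponentMk h = c ∧ a h ≠ 0 := fun h hne => by
    by_cases h' : Γ.connectedComponentMk h = c
    · exact ⟨h', by simpa [u, h'] using hne⟩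
    · simp [u, h'] at hne
  -- Left translation commutes with right displacement, so the component can be moved to contain the
  -- identity.
  have hshift : ∀ v : G → ℝ, ∑ x, v (h₀ * x) = ∑ x, v x :=
    fun v => Equiv.sum_comp (Equiv.mulLeft h₀) v
  have hnorm : ∑ x, u c (h₀ * x) ^ 2 = ∑ x, u c x ^ 2 := hshift fun x => u c x ^ 2
  refine ⟨_, AlmostInvariant.normalize (u := fun x => u c (h₀ * x)) (fun x => ?_) ?_
    (fun s hs => ?_), fun g hg => ?_⟩
  · simp only [u]; split_ifs; exacts [ha.nonneg _, le_rfl]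
  · rwa [hnorm]
  · rw [hnorm]
    refine le_trans ?_ hc
    simp_rw [← mul_assoc]
    rw [hshift fun x => (u c x - u c (x * s)) ^ 2]
    exact Finset.single_le_sum (f := fun s => ∑ h, (u c h - u c (h * s)) ^ 2)
      (fun s _ => Finset.sum_nonneg fun h _ => sq_nonneg _) hs
  · have hg : u c (h₀ * g) ≠ 0 := fun h => hg (by simp [h])
    have hr : Γ.Reachable h₀ (h₀ * g) :=
      SimpleGraph.ConnectedComponent.exact ((hu _ hh₀).1.trans (hu _ hg).1.symm)
    simpa using wordLength_le_of_reachable hS hr (hu _ hh₀).2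

/-! ### Displacement of the densities $a^2$ in $\ell^1$. -/

section L1

variable {G : Type*} [Group G] [Fintype G] {S : Set G} {ε : ℝ} {a : G → ℝ}

/-- Cauchy–Schwarz applied to $|p^2-q^2|=|p-q|(p+q)$, with $\|p+q\|_2\le2$ for unit vectors. -/
theorem AlmostInvariant.sum_abs_sq_sub_sq_le (ha : AlmostInvariant S ε a) (hε : 0 ≤ ε) {s : G}
    (hs : s ∈ S) : ∑ x, |a x ^ 2 - a (x * s) ^ 2| ≤ 2 * ε := by
  have hs2 : ∑ x, a (x * s) ^ 2 = 1 :=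
    (Equiv.sum_comp (Equiv.mulRight s) fun x => a x ^ 2).trans ha.sum_sq
  have h4 : ∑ x, (a x + a (x * s)) ^ 2 ≤ 4 := by
    have : ∑ x, (a x + a (x * s)) ^ 2 ≤ ∑ x, (2 * a x ^ 2 + 2 * a (x * s) ^ 2) :=
      Finset.sum_le_sum fun x _ => by nlinarith [sq_nonneg (a x - a (x * s))]
    rw [Finset.sum_add_distrib, ← Finset.mul_sum, ← Finset.mul_sum, ha.sum_sq, hs2] at this
    linarith
  refine le_of_sq_le_sq ?_ (by positivity)
  calc (∑ x, |a x ^ 2 - a (x * s) ^ 2|) ^ 2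
      = (∑ x, |a x - a (x * s)| * (a x + a (x * s))) ^ 2 := by
        congr 1
        refine Finset.sum_congr rfl fun x _ => ?_
        rw [← abs_of_nonneg (add_nonneg (ha.nonneg x) (ha.nonneg (x * s))), ← abs_mul]
        congr 1
        ring
    _ ≤ (∑ x, |a x - a (x * s)| ^ 2) * ∑ x, (a x + a (x * s)) ^ 2 :=
        Finset.sum_mul_sq_le_sq_mul_sq _ _ _
    _ ≤ ε ^ 2 * 4 := by
        simp_rw [sq_abs]
        gcongr
        exact ha.sum_sq_sub_le s hs
    _ = (2 * ε) ^ 2 := by ring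

/-- Telescoping along a shortest word for `g`, each letter costing $2\varepsilon$. -/
theorem AlmostInvariant.sum_abs_sq_sub_sq_mul_le (ha : AlmostInvariant S ε a) (hε : 0 ≤ ε)
    (hS : Subgroup.closure S = ⊤) (g : G) :
    ∑ x, |a x ^ 2 - a (x * g) ^ 2| ≤ wordLength S g * (2 * ε) := by
  obtain ⟨w, hw, hwS, rfl⟩ := exists_word hS g
  rw [← hw]
  clear hw
  induction w with
  | nil => simp
  | cons s w ih =>
    have hs : ∑ x, |a x ^ 2 - a (x * s) ^ 2| ≤ 2 * ε := by
      rcases hwS s (by simp) with h | h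
      · exact ha.sum_abs_sq_sub_sq_le hε h
      · refine (le_of_eq ?_).trans (ha.sum_abs_sq_sub_sq_le hε h)
        rw [← Equiv.sum_comp (Equiv.mulRight s) fun x => |a x ^ 2 - a (x * s⁻¹) ^ 2|]
        refine Finset.sum_congr rfl fun x _ => ?_
        simp [abs_sub_comm]
    have hw := ih fun b hb => hwS b (List.mem_cons_of_mem _ hb)
    rw [← Equiv.sum_comp (Equiv.mulRight s)] at hw
    calc ∑ x, |a x ^ 2 - a (x * (s :: w).prod) ^ 2|
        ≤ ∑ x, (|a x ^ 2 - a (x * s) ^ 2| + |a (x * s) ^ 2 - a (x * s * w.prod) ^ 2|) := by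
          refine Finset.sum_le_sum fun x _ => ?_
          rw [List.prod_cons, ← mul_assoc]
          exact abs_sub_le _ _ _
      _ ≤ _ := by
          rw [Finset.sum_add_distrib, List.length_cons]
          push_cast
          simp only [Equiv.coe_mulRight] at hw
          linarith

end L1

/-! ### Rounding densities to finite subsets of $Y\times\mathbb N$. -/

section Subgraph

variable {Y : Type*}

/-- The region `{(y, j) | j < φ y}` below the graph of `φ`. -/
def regionBelow (φ : Y → ℕ) : Set (Y × ℕ) := {p | p.2 < φ p.1}

theorem regionBelow_inter (φ ψ : Y → ℕ) :
    regionBelow φ ∩ regionBelow ψ = regionBelow (φ ⊓ ψ) := by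
  ext p; simp [regionBelow]

theorem regionBelow_union (φ ψ : Y → ℕ) :
    regionBelow φ ∪ regionBelow ψ = regionBelow (φ ⊔ ψ) := by
  ext p; simp [regionBelow]

variable [Fintype Y]

theorem regionBelow_eq_image (φ : Y → ℕ) :
    regionBelow φ = (fun p : Σ _ : Y, ℕ => (p.1, p.2)) ''
      (Finset.univ.sigma fun y => Finset.range (φ y) : Finset (Σ _ : Y, ℕ)) := by
  ext ⟨y, j⟩; simp [regionBelow]

theorem finite_regionBelow (φ : Y → ℕ) : (regionBelow φ).Finite := by
  rw [regionBelow_eq_image]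
  exact (Finset.finite_toSet _).image _

theorem ncard_regionBelow (φ : Y → ℕ) : (regionBelow φ).ncard = ∑ y, φ y := by
  rw [regionBelow_eq_image, Set.ncard_image_of_injective _
    (fun p q h => by cases p; cases q; simp_all), Set.ncard_coe_finset, Finset.card_sigma]
  simp

theorem ncard_regionBelow_symmDiff (φ ψ : Y → ℕ) :
    ((regionBelow φ ∆ regionBelow ψ).ncard : ℝ) = ∑ y, |(φ y : ℝ) - ψ y| := by
  rw [symmDiff_eq_sup_sdiff_inf]
  change (((regionBelow φ ∪ regionBelow ψ) \ (regionBelow φ ∩ regionBelow ψ)).ncard : ℝ) = _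
  have hsub : regionBelow φ ∩ regionBelow ψ ⊆ regionBelow φ ∪ regionBelow ψ :=
    Set.inter_subset_left.trans Set.subset_union_left
  rw [Set.cast_ncard_sdiff hsub ((finite_regionBelow φ).union (finite_regionBelow ψ)),
    regionBelow_inter, regionBelow_union, ncard_regionBelow, ncard_regionBelow]
  push_cast
  rw [← Finset.sum_sub_distrib]
  refine Finset.sum_congr rfl fun y _ => ?_
  simp only [Pi.sup_apply, Pi.inf_apply, Nat.cast_max, Nat.cast_min]
  exact max_sub_min_eq_abs' _ _

/-- Discretising two close probability densities with small supports gives finite sets with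
relatively small symmetric difference. -/
theorem regionBelow_floor_ratio_le {b b' : Y → ℝ} (hb : ∀ y, 0 ≤ b y) (hb' : ∀ y, 0 ≤ b' y)
    (hsum : ∑ y, b y = 1) {B : ℕ} (hB : (Function.support b).ncard ≤ B)
    (hB' : (Function.support b').ncard ≤ B) {δ K : ℝ} (hδ : δ ≤ 1 / 8) (hK : 0 < K)
    (hBK : B ≤ K * δ / 2) (hbb' : ∑ y, |b y - b' y| ≤ δ) :
    (regionBelow (fun y => ⌊K * b y⌋₊) ∩ regionBelow (fun y => ⌊K * b' y⌋₊)).Nonempty ∧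
      ((regionBelow (fun y => ⌊K * b y⌋₊) ∆ regionBelow (fun y => ⌊K * b' y⌋₊)).ncard : ℝ) /
        ((regionBelow (fun y => ⌊K * b y⌋₊) ∩ regionBelow (fun y => ⌊K * b' y⌋₊)).ncard : ℝ)
        ≤ 4 * δ := by
  classical
  have hind : ∀ c : Y → ℝ, ∑ y, (if c y = 0 then (0 : ℝ) else 1) = (Function.support c).ncard := by
    intro c
    rw [Set.ncard_eq_toFinset_card', Finset.card_eq_sum_ones, Nat.cast_sum,
      ← Finset.sum_filter_add_sum_filter_not Finset.univ (fun y => c y = 0),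
      Finset.sum_ite_of_true (by simp), Finset.sum_ite_of_false (by simp)]
    simp only [Finset.sum_const_zero, zero_add, Nat.cast_one]
    congr 1
    ext y
    simp
  have hfl : ∀ c : Y → ℝ, (∀ y, 0 ≤ c y) → ∀ y,
      (⌊K * c y⌋₊ : ℝ) ≤ K * c y ∧ K * c y - (if c y = 0 then (0 : ℝ) else 1) ≤ ⌊K * c y⌋₊ := by
    intro c hc y
    refine ⟨Nat.floor_le (mul_nonneg hK.le (hc y)), ?_⟩
    split_ifs with h
    · simp [h]
    · exact (Nat.sub_one_lt_floor _).le
  -- Scaling contributes $K\delta$; rounding contributes at most 1 per support point, so at most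
  -- $2B\le K\delta$ in all.
  have hdiff : ∑ y, |(⌊K * b y⌋₊ : ℝ) - ⌊K * b' y⌋₊| ≤ 2 * K * δ := by
    calc _ ≤ ∑ y, (K * |b y - b' y| + (if b y = 0 then (0 : ℝ) else 1) +
            (if b' y = 0 then (0 : ℝ) else 1)) := by
          refine Finset.sum_le_sum fun y _ => ?_
          obtain ⟨h1, h2⟩ := hfl b hb y
          obtain ⟨h3, h4⟩ := hfl b' hb' y
          have h5 : (0 : ℝ) ≤ if b y = 0 then (0 : ℝ) else 1 := by split_ifs <;> simp
          have h6 : (0 : ℝ) ≤ if b' y = 0 then (0 : ℝ) else 1 := by split_ifs <;> simp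
          have h7 := mul_le_mul_of_nonneg_left (le_abs_self (b y - b' y)) hK.le
          have h8 := mul_le_mul_of_nonneg_left (neg_abs_le (b y - b' y)) hK.le
          rw [abs_le]
          constructor <;> nlinarith
      _ ≤ 2 * K * δ := by
          rw [Finset.sum_add_distrib, Finset.sum_add_distrib, ← Finset.mul_sum, hind, hind]
          have h1 : ((Function.support b).ncard : ℝ) ≤ B := by exact_mod_cast hB
          have h2 : ((Function.support b').ncard : ℝ) ≤ B := by exact_mod_cast hB'
          nlinarith
  -- The minimum has total at least $K-B-2K\delta\ge K-K/16-K/4$.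
  have hinter : K / 2 ≤
      ((regionBelow (fun y => ⌊K * b y⌋₊) ∩ regionBelow (fun y => ⌊K * b' y⌋₊)).ncard : ℝ) := by
    rw [regionBelow_inter, ncard_regionBelow]
    push_cast
    have h1 : ∑ y, (K * b y - (if b y = 0 then (0 : ℝ) else 1) -
        |(⌊K * b y⌋₊ : ℝ) - ⌊K * b' y⌋₊|) ≤
        ∑ y, ((((fun y => ⌊K * b y⌋₊) ⊓ (fun y => ⌊K * b' y⌋₊)) y : ℕ) : ℝ) := by
      refine Finset.sum_le_sum fun y _ => ?_
      obtain ⟨-, h2⟩ := hfl b hb y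
      have h3 := le_abs_self ((⌊K * b y⌋₊ : ℝ) - ⌊K * b' y⌋₊)
      have h4 := abs_nonneg ((⌊K * b y⌋₊ : ℝ) - ⌊K * b' y⌋₊)
      simp only [Pi.inf_apply, Nat.cast_min]
      exact le_min (by linarith) (by linarith)
    rw [Finset.sum_sub_distrib, Finset.sum_sub_distrib, ← Finset.mul_sum, hsum, hind] at h1
    have h2 : ((Function.support b).ncard : ℝ) ≤ B := by exact_mod_cast hB
    nlinarith
  refine ⟨?_, ?_⟩
  · by_contra h
    rw [Set.not_nonempty_iff_eq_empty.1 h] at hinter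
    simp at hinter
    linarith
  · rw [ncard_regionBelow_symmDiff, div_le_iff₀ (by linarith)]
    have h0 : 0 ≤ δ := (Finset.sum_nonneg fun y _ => abs_nonneg _).trans hbb'
    nlinarith

end Subgraph

/-! ### From densities indexed by points to a single almost invariant vector. -/

/-- Averaging a family of probability densities over a finite group, by left translation. -/
theorem exists_almostInvariant_of_density {G : Type*} [Group G] [Fintype G] {S : Set G} {ε : ℝ}
    {b : G → G → ℝ} (hb : ∀ x z, 0 ≤ b x z) (hsum : ∀ x, ∑ z, b x z = 1)
    (hS : ∀ s ∈ S, ∀ x, ∑ z, |b x z - b (x * s) z| ≤ ε ^ 2) :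
    ∃ a, AlmostInvariant S ε a ∧ ∀ g, a g ≠ 0 → ∃ z, b (z * g) z ≠ 0 := by
  set N : ℝ := (Fintype.card G : ℝ) with hN
  have hN0 : 0 < N := by simp [hN, Fintype.card_pos]
  set q : G → ℝ := fun g => (∑ z, b (z * g) z) / N with hq
  have hq0 : ∀ g, 0 ≤ q g := fun g => div_nonneg (Finset.sum_nonneg fun z _ => hb _ _) hN0.le
  have hshift : ∀ (z : G) (v : G → ℝ), ∑ g, v (z * g) = ∑ g, v g :=
    fun z v => Equiv.sum_comp (Equiv.mulLeft z) v
  refine ⟨fun g => √(q g), ⟨fun g => Real.sqrt_nonneg _, ?_, fun s hs => ?_⟩, fun g hg => ?_⟩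
  · simp_rw [Real.sq_sqrt (hq0 _), hq]
    rw [← Finset.sum_div, Finset.sum_comm]
    simp_rw [fun z => hshift z fun x => b x z]
    rw [Finset.sum_comm]
    simp_rw [hsum]
    simp [← hN, hN0.ne']
  -- Square roots turn $\ell^1$-closeness into $\ell^2$-closeness by $(\sqrt p-\sqrt q)^2\le|p-q|$.
  · calc ∑ g, (√(q g) - √(q (g * s))) ^ 2 ≤ ∑ g, |q g - q (g * s)| := by
          refine Finset.sum_le_sum fun g _ => ?_
          have h1 := Real.sq_sqrt (hq0 g)
          have h2 := Real.sq_sqrt (hq0 (g * s))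
          have h3 := Real.sqrt_nonneg (q g)
          have h4 := Real.sqrt_nonneg (q (g * s))
          rcases le_total (√(q g)) (√(q (g * s))) with h | h
          · refine le_trans ?_ (neg_le_abs _)
            nlinarith
          · refine le_trans ?_ (le_abs_self _)
            nlinarith
      _ ≤ ∑ g, (∑ z, |b (z * g) z - b (z * g * s) z|) / N := by
          refine Finset.sum_le_sum fun g _ => ?_
          simp only [hq]
          rw [← sub_div, ← Finset.sum_sub_distrib, abs_div, abs_of_pos hN0]
          simp_rw [← mul_assoc]
          gcongr
          exact Finset.abs_sum_le_sum_abs _ _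
      _ = (∑ x, ∑ z, |b x z - b (x * s) z|) / N := by
          rw [← Finset.sum_div, Finset.sum_comm]
          simp_rw [fun z => hshift z fun x => |b x z - b (x * s) z|]
          rw [Finset.sum_comm]
      _ ≤ (∑ _x : G, ε ^ 2) / N := by
          gcongr with x
          exact hS s hs x
      _ = ε ^ 2 := by
          simp only [Finset.sum_const, Finset.card_univ, nsmul_eq_mul, ← hN]
          field_simp
  · by_contra! h
    exact hg (by simp [hq, h])

/-- The normalised fibre counts of two finite sets are close in `ℓ¹` if the sets are. -/
theorem sum_abs_fiber_density_sub_le {Z Y : Type*} [Fintype Y] [DecidableEq Y] [DecidableEq Z]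
    (r : Z → Y) {P Q : Finset Z} (hPQ : (P ∩ Q).Nonempty) {ε : ℝ}
    (h : ((P ∆ Q).card : ℝ) / ((P ∩ Q).card : ℝ) ≤ ε) :
    ∑ y, |((P.filter fun p => r p = y).card : ℝ) / P.card -
      ((Q.filter fun p => r p = y).card : ℝ) / Q.card| ≤ 2 * ε := by
  have hI : (0 : ℝ) < (P ∩ Q).card := by exact_mod_cast hPQ.card_pos
  have hIP : ((P ∩ Q).card : ℝ) ≤ P.card := by
    exact_mod_cast Finset.card_le_card Finset.inter_subset_left
  have hIQ : ((P ∩ Q).card : ℝ) ≤ Q.card := by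
    exact_mod_cast Finset.card_le_card Finset.inter_subset_right
  have hP : (0 : ℝ) < P.card := hI.trans_le hIP
  have hQ : (0 : ℝ) < Q.card := hI.trans_le hIQ
  have htot : ∀ T : Finset Z, ∑ y, ((T.filter fun p => r p = y).card : ℝ) = T.card := fun T => by
    exact_mod_cast (Finset.card_eq_sum_card_fiberwise fun x _ => Finset.mem_coe.2
      (Finset.mem_univ (r x))).symm
  have hsub : ∀ T U : Finset Z, (T.card : ℝ) ≤ U.card + (T ∆ U).card := fun T U => by
    have h1 : T ⊆ U ∪ T ∆ U := fun x hx => by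
      by_cases hxU : x ∈ U <;> simp [Finset.mem_symmDiff, hx, hxU]
    exact_mod_cast (Finset.card_le_card h1).trans (Finset.card_union_le _ _)
  have habs : ∀ T U : Finset Z, |(T.card : ℝ) - U.card| ≤ (T ∆ U).card := fun T U => by
    have h1 := hsub T U
    have h2 := hsub U T
    rw [symmDiff_comm] at h2
    exact abs_sub_le_iff.2 ⟨by linarith, by linarith⟩
  have hfib : ∀ y, |((P.filter fun p => r p = y).card : ℝ) - (Q.filter fun p => r p = y).card| ≤
      (((P ∆ Q).filter fun p => r p = y).card : ℝ) := fun y => by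
    refine (habs _ _).trans_eq ?_
    congr 2
    ext p
    simp only [Finset.mem_symmDiff, Finset.mem_filter]
    tauto
  calc _ ≤ ∑ y, ((((P ∆ Q).filter fun p => r p = y).card : ℝ) / P.card +
          ((Q.filter fun p => r p = y).card : ℝ) * (((P ∆ Q).card : ℝ) / (P.card * Q.card))) := by
        refine Finset.sum_le_sum fun y _ => ?_
        set c : ℝ := ((P.filter fun p => r p = y).card : ℝ)
        set d : ℝ := ((Q.filter fun p => r p = y).card : ℝ) with hd
        -- One term compares the fibres, the other the total sizes; each sums over `y` to at most
        -- $\sharp(P\triangle Q)/\sharp P$.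
        have : c / P.card - d / Q.card =
            (c - d) / P.card + d * ((Q.card - P.card) / (P.card * Q.card)) := by
          field_simp
          ring
        rw [this]
        refine (abs_add_le _ _).trans ?_
        rw [abs_div, abs_of_pos hP, abs_mul, abs_div, abs_of_pos (mul_pos hP hQ),
          abs_of_nonneg (by rw [hd]; positivity : 0 ≤ d), abs_sub_comm (Q.card : ℝ)]
        gcongr
        exacts [hfib y, habs P Q]
    _ = 2 * ((P ∆ Q).card / P.card) := by
        rw [Finset.sum_add_distrib, ← Finset.sum_div, ← Finset.sum_mul, htot, htot]
        field_simp
        ring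
    _ ≤ 2 * ((P ∆ Q).card / (P ∩ Q).card) := by gcongr
    _ ≤ 2 * ε := by gcongr

/-! ### Property A of the coarse disjoint union. -/

section CoarseUnion

variable {G : ℕ → Type*} [∀ n, Group (G n)] {S : ∀ n, Finset (G n)}
  {hS : ∀ n, Subgroup.closure (S n : Set (G n)) = ⊤} {D : MetricSpace (Σ n, G n)}

theorem IsCoarseDisjointUnion.dist_eq
    (hD : IsCoarseDisjointUnion (fun n => wordMetricSpace (S n : Set (G n)) (hS n)) D) (n : ℕ)
    (x y : G n) : D.dist ⟨n, x⟩ ⟨n, y⟩ = wordLength (S n : Set (G n)) (x⁻¹ * y) :=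
  hD.1 n x y

theorem IsCoarseDisjointUnion.add_le_dist
    (hD : IsCoarseDisjointUnion (fun n => wordMetricSpace (S n : Set (G n)) (hS n)) D) {n m : ℕ}
    (hnm : n ≠ m) (x : G n) (y : G m) : (n : ℝ) + m ≤ D.dist ⟨n, x⟩ ⟨m, y⟩ := by
  refine le_trans ?_ (hD.2 n m hnm x y)
  have h1 := @Metric.diam_nonneg (G n) Set.univ
    (wordMetricSpace (S n : Set (G n)) (hS n)).toPseudoMetricSpace
  have h2 := @Metric.diam_nonneg (G m) Set.univ
    (wordMetricSpace (S m : Set (G m)) (hS m)).toPseudoMetricSpace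
  linarith

variable [∀ n, Fintype (G n)]

theorem propertyA_of_almostInvariant {L : ℕ} (hL : ∀ n, (S n).card ≤ L)
    (hD : IsCoarseDisjointUnion (fun n => wordMetricSpace (S n : Set (G n)) (hS n)) D)
    (H : ∀ ε > (0 : ℝ), ∃ k : ℕ, ∃ a : ∀ n, G n → ℝ, ∀ n,
      AlmostInvariant (S n : Set (G n)) ε (a n) ∧
        ∀ g, a n g ≠ 0 → wordLength (S n : Set (G n)) g ≤ k) :
    @PropertyA (Σ n, G n) D := by
  classical
  let _ := D
  intro ε hε R hR
  set δ : ℝ := min ε 1 / 8 with hδ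
  have hδ0 : 0 < δ := by positivity
  have hδ1 : δ ≤ 1 / 8 := by rw [hδ]; linarith [min_le_right ε 1]
  have hδε : 4 * δ ≤ ε := by rw [hδ]; linarith [min_le_left ε 1]
  -- Points at distance at most `R` differ by a word of length at most `R`, and each letter costs
  -- twice this constant: `δ` in all.
  obtain ⟨k, a, ha⟩ := H (δ / (2 * R)) (by positivity)
  set B : ℕ := (2 * L + 1) ^ k with hB
  have hB0 : (0 : ℝ) < B := by rw [hB]; positivity
  set K : ℝ := 2 * B / δ with hK
  have hK0 : 0 < K := by positivity
  set b : ∀ n, G n → G n → ℝ := fun n x z => a n (z⁻¹ * x) ^ 2 with hb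
  set F : Finset (Σ n, G n) := (Finset.range (⌊R⌋₊ + 1)).sigma fun n => Finset.univ with hF
  have hmemF : ∀ p : Σ n, G n, (p.1 : ℝ) ≤ R → p ∈ F := fun p hp => by
    simpa [hF, Nat.lt_succ_iff] using Nat.le_floor hp
  set e : ∀ n, G n × ℕ → (Σ n, G n) × ℕ := fun n q => (⟨n, q.1⟩, q.2) with he
  have heinj : ∀ n, Function.Injective (e n) := fun n p q h => by
    simpa [he, Prod.ext_iff] using h
  set V : ∀ n, G n → Set (G n × ℕ) := fun n x => regionBelow fun z => ⌊K * b n x z⌋₊ with hV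
  have hVsupp : ∀ n x p, p ∈ V n x → wordLength (S n : Set (G n)) (p.1⁻¹ * x) ≤ k := by
    intro n x p hp
    refine (ha n).2 _ fun h0 => ?_
    simp [hV, regionBelow, hb, h0] at hp
  have hbB : ∀ n x, (Function.support (b n x)).ncard ≤ B := fun n x => by
    refine le_trans ?_ (ncard_wordLength_le (hS n) (hL n) k)
    refine Set.ncard_le_ncard_of_injOn (fun z => z⁻¹ * x) (fun z hz => ?_) (fun z _ w _ h => ?_)
      (Set.toFinite _)
    · exact (ha n).2 _ fun h0 => hz (by simp [hb, h0])
    · simpa using h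
  have hre : ∀ n (x : G n) (v : G n → ℝ), ∑ z, v (z⁻¹ * x) = ∑ z, v z := fun n x v =>
    Equiv.sum_comp ((Equiv.inv (G n)).trans (Equiv.mulRight x)) v
  have hbsum : ∀ n x, ∑ z, b n x z = 1 := fun n x =>
    (hre n x fun z => a n z ^ 2).trans (ha n).1.sum_sq
  have hbclose : ∀ n x y, D.dist ⟨n, x⟩ ⟨n, y⟩ ≤ R → ∑ z, |b n x z - b n y z| ≤ δ := by
    intro n x y hxy
    have h1 : ∑ z, |b n x z - b n y z| = ∑ h, |a n h ^ 2 - a n (h * (x⁻¹ * y)) ^ 2| := by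
      rw [← hre n x fun h => |a n h ^ 2 - a n (h * (x⁻¹ * y)) ^ 2|]
      refine Finset.sum_congr rfl fun z _ => ?_
      simp only [hb]
      rw [show z⁻¹ * x * (x⁻¹ * y) = z⁻¹ * y by group]
    rw [h1]
    refine ((ha n).1.sum_abs_sq_sub_sq_mul_le (by positivity) (hS n) _).trans ?_
    rw [hD.dist_eq] at hxy
    calc _ ≤ R * (2 * (δ / (2 * R))) := by gcongr
      _ = δ := by field_simp
  have hbdd : Bornology.IsBounded (F : Set (Σ n, G n)) := F.finite_toSet.isBounded
  -- Distinct blocks `n`, `m` are at distance at least `n + m`. So points within `R` of each other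
  -- lie in one block or both in `F`, the finite union of the blocks up to `R`, where a single
  -- common set serves every point.
  refine ⟨fun p => if (p.1 : ℝ) ≤ R then (F : Set (Σ n, G n)) ×ˢ {0} else e p.1 '' V p.1 p.2,
    k + Metric.diam (F : Set (Σ n, G n)) + 1, ?_, ?_, ?_, ?_⟩
  · have := Metric.diam_nonneg (s := (F : Set (Σ n, G n)))
    positivity
  · intro p
    dsimp only
    split_ifs
    · exact F.finite_toSet.prod (Set.finite_singleton 0)
    · exact (finite_regionBelow _).image _
  · rintro ⟨n, x⟩ ⟨m, y⟩ hxy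
    dsimp only
    by_cases hn : (n : ℝ) ≤ R
    · have hm : (m : ℝ) ≤ R := by
        by_cases hnm : n = m
        · rwa [← hnm]
        · have := hD.add_le_dist hnm x y
          have h2 : D.dist ⟨n, x⟩ ⟨m, y⟩ ≤ R := hxy
          have h3 : (0 : ℝ) ≤ n := Nat.cast_nonneg n
          linarith
      rw [if_pos hn, if_pos hm, Set.inter_self, symmDiff_self]
      refine ⟨⟨(⟨n, x⟩, 0), hmemF ⟨n, x⟩ hn, rfl⟩, ?_⟩
      simpa using hε.le
    · have hnm : n = m := by
        by_contra hnm
        have := hD.add_le_dist hnm x y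
        have h2 : D.dist ⟨n, x⟩ ⟨m, y⟩ ≤ R := hxy
        have h3 : (0 : ℝ) ≤ m := Nat.cast_nonneg m
        linarith
      subst hnm
      rw [if_neg hn, if_neg hn, ← Set.image_inter (heinj n), ← Set.image_symmDiff (heinj n),
        Set.ncard_image_of_injective _ (heinj n), Set.ncard_image_of_injective _ (heinj n),
        Set.image_nonempty]
      have := regionBelow_floor_ratio_le (b := b n x) (b' := b n y) (fun z => sq_nonneg _)
        (fun z => sq_nonneg _) (hbsum n x) (hbB n x) (hbB n y) hδ1 hK0
        (by rw [hK]; field_simp; rfl) (hbclose n x y hxy)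
      exact ⟨this.1, this.2.trans hδε⟩
  · rintro ⟨n, x⟩ p hp
    refine ⟨?_, Set.mem_univ _⟩
    rw [Metric.mem_closedBall]
    dsimp only at hp
    split_ifs at hp with hn
    · have := Metric.dist_le_diam_of_mem hbdd hp.1 (hmemF ⟨n, x⟩ hn)
      have h0 : (0 : ℝ) ≤ k := Nat.cast_nonneg k
      linarith
    · obtain ⟨q, hq, rfl⟩ := hp
      have h1 : dist (e n q).1 ⟨n, x⟩ = wordLength (S n : Set (G n)) (q.1⁻¹ * x) :=
        hD.dist_eq n q.1 x
      have h2 : (wordLength (S n : Set (G n)) (q.1⁻¹ * x) : ℝ) ≤ k := by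
        exact_mod_cast hVsupp n x q hq
      have h3 := Metric.diam_nonneg (s := (F : Set (Σ n, G n)))
      linarith

theorem exists_almostInvariant_of_propertyA
    (hD : IsCoarseDisjointUnion (fun n => wordMetricSpace (S n : Set (G n)) (hS n)) D)
    (hA : @PropertyA (Σ n, G n) D) {ε : ℝ} (hε : 0 < ε) :
    ∃ k : ℕ, ∃ a : ∀ n, G n → ℝ, ∀ n, AlmostInvariant (S n : Set (G n)) ε (a n) ∧
      ∀ g, a n g ≠ 0 → wordLength (S n : Set (G n)) g ≤ k := by
  classical
  let _ := D
  -- Scale 1 suffices, since a generator moves points by at most 1; the bound $\varepsilon^2/2$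
  -- doubles on passing to densities.
  obtain ⟨A, C, hC, hfin, hclose, hsupp⟩ := hA (ε ^ 2 / 2) (by positivity) 1 one_pos
  set c : ℕ := ⌊C⌋₊ with hc
  -- The sum bounds all word lengths in the finitely many blocks with `n ≤ C`, where the constant
  -- vector is used.
  set k : ℕ := c + ∑ n ∈ Finset.range (c + 1), ∑ g : G n, wordLength (S n : Set (G n)) g with hk
  suffices h : ∀ n, ∃ a : G n → ℝ, AlmostInvariant (S n : Set (G n)) ε a ∧
      ∀ g, a g ≠ 0 → wordLength (S n : Set (G n)) g ≤ k by
    choose a ha using h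
    exact ⟨k, a, ha⟩
  intro n
  by_cases hn : n ≤ c
  · refine ⟨_, AlmostInvariant.const _ _, fun g _ => ?_⟩
    have h1 : wordLength (S n : Set (G n)) g ≤ ∑ g : G n, wordLength (S n : Set (G n)) g :=
      Finset.single_le_sum (f := fun g => wordLength (S n : Set (G n)) g) (fun _ _ => Nat.zero_le _)
        (Finset.mem_univ g)
    have h2 : ∑ g : G n, wordLength (S n : Set (G n)) g ≤
        ∑ n ∈ Finset.range (c + 1), ∑ g : G n, wordLength (S n : Set (G n)) g :=
      Finset.single_le_sum (f := fun n => ∑ g : G n, wordLength (S n : Set (G n)) g)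
        (fun _ _ => Nat.zero_le _) (Finset.mem_range.2 (Nat.lt_succ_of_le hn))
    omega
  have hCn : C < n := (Nat.floor_lt hC.le).1 (not_le.1 hn)
  set P : G n → Finset ((Σ n, G n) × ℕ) := fun x => (hfin ⟨n, x⟩).toFinset with hP
  have hPcoe : ∀ x, (P x : Set ((Σ n, G n) × ℕ)) = A ⟨n, x⟩ := fun x => by simp [hP]
  -- The default 1 never matters: for `n > C` a ball of radius `C` about a point of block `n` stays
  -- in that block.
  let r : (Σ n, G n) × ℕ → G n := fun p => if h : p.1.1 = n then h ▸ p.1.2 else 1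
  have hPclose : ∀ x y, D.dist ⟨n, x⟩ ⟨n, y⟩ ≤ 1 → (P x ∩ P y).Nonempty ∧
      ((P x ∆ P y).card : ℝ) / ((P x ∩ P y).card : ℝ) ≤ ε ^ 2 / 2 := by
    intro x y hxy
    have := hclose _ _ hxy
    rw [← hPcoe, ← hPcoe, ← Finset.coe_inter, ← Finset.coe_symmDiff, Set.ncard_coe_finset,
      Set.ncard_coe_finset, Finset.coe_nonempty] at this
    exact this
  have hPpos : ∀ x, (0 : ℝ) < (P x).card := fun x => by
    have := (hPclose x x (by rw [D.dist_self]; exact zero_le_one)).1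
    rw [Finset.inter_self] at this
    exact_mod_cast this.card_pos
  obtain ⟨a, ha, hsa⟩ := exists_almostInvariant_of_density (S := (S n : Set (G n))) (ε := ε)
    (b := fun x z => (((P x).filter fun p => r p = z).card : ℝ) / (P x).card)
    (fun x z => by positivity)
    (fun x => by
      rw [← Finset.sum_div, div_eq_one_iff_eq (hPpos x).ne']
      exact_mod_cast (Finset.card_eq_sum_card_fiberwise fun p _ => Finset.mem_coe.2
        (Finset.mem_univ (r p))).symm)
    (fun s hs x => by
      have hd : D.dist ⟨n, x⟩ ⟨n, x * s⟩ ≤ 1 := by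
        rw [hD.dist_eq, inv_mul_cancel_left]
        exact_mod_cast wordLength_le_one (Or.inl hs)
      obtain ⟨h1, h2⟩ := hPclose _ _ hd
      exact (sum_abs_fiber_density_sub_le r h1 h2).trans_eq (by ring))
  refine ⟨a, ha, fun g hg => ?_⟩
  obtain ⟨z, hz⟩ := hsa g hg
  have hne : ((P (z * g)).filter fun p => r p = z).Nonempty := by
    rw [Finset.nonempty_iff_ne_empty]
    intro h
    simp [h] at hz
  obtain ⟨⟨⟨m, w⟩, j⟩, hp⟩ := hne
  obtain ⟨hp, hrp⟩ := Finset.mem_filter.1 hp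
  have hball : D.dist ⟨m, w⟩ ⟨n, z * g⟩ ≤ C := by
    have := (hsupp ⟨n, z * g⟩ ((hPcoe _).subset (Finset.mem_coe.2 hp))).1
    exact Metric.mem_closedBall.1 this
  have hmn : m = n := by
    by_contra hmn
    have h1 := hD.add_le_dist hmn w (z * g)
    have h2 : (0 : ℝ) ≤ m := Nat.cast_nonneg m
    linarith
  subst hmn
  have hw : w = z := by simpa [r] using hrp
  subst hw
  rw [hD.dist_eq, inv_mul_cancel_left] at hball
  have := Nat.le_floor hball
  omega

end CoarseUnion

/-! ### The equivalences. -/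

theorem corollary3p8 (G : ℕ → Type*) [∀ n, Group (G n)] [∀ n, Fintype (G n)]
    (S : ∀ n, Finset (G n)) (hS : ∀ n, Subgroup.closure (S n : Set (G n)) = ⊤)
    (L : ℕ) (hL : ∀ n, (S n).card ≤ L)
    (D : MetricSpace (Σ n, G n))
    (hD : IsCoarseDisjointUnion (fun n => wordMetricSpace (S n : Set (G n)) (hS n)) D) :
    List.TFAE [
      ∀ ε > (0 : ℝ), ∃ M > (0 : ℝ), ∃ f : ∀ n, G n → ℂ, ∀ n,
        f n ∈ ellUnitNonneg 2 (G n) ∧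
        (∀ s ∈ S n, ellNorm 2 (f n - rightTranslate s (f n)) ≤ ε) ∧
        ellNorm 1 (f n) ≤ M,
      ∀ ε > (0 : ℝ), ∃ M' > (0 : ℝ), ∃ f : ∀ n, G n → ℂ, ∀ n,
        f n ∈ ellUnitNonneg 2 (G n) ∧
        (∀ s ∈ S n, ellNorm 2 (f n - rightTranslate s (f n)) ≤ ε) ∧
        ‖associatedOperator (f n)‖ ≤ M',
      ∀ ε > (0 : ℝ), ∃ N > (0 : ℕ), ∃ f : ∀ n, G n → ℂ, ∀ n,
        f n ∈ ellUnitNonneg 2 (G n) ∧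
        (∀ s ∈ S n, ellNorm 2 (f n - rightTranslate s (f n)) ≤ ε) ∧
        (Function.support (f n)).ncard ≤ N,
      UniformlyAmenable G (fun n => (S n : Set (G n))),
      @PropertyA (Σ n, G n) D] := by
  have hsupp : ∀ n (a : G n → ℝ),
      (Function.support fun x => (a x : ℂ)) = Function.support a := fun n a => by
    ext; simp
  have h1 : (∀ ε > (0 : ℝ), ∃ M > (0 : ℝ), ∃ f : ∀ n, G n → ℂ, ∀ n,
        f n ∈ ellUnitNonneg 2 (G n) ∧
        (∀ s ∈ S n, ellNorm 2 (f n - rightTranslate s (f n)) ≤ ε) ∧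
        ellNorm 1 (f n) ≤ M) ↔
      ∀ ε > (0 : ℝ), ∃ M > (0 : ℝ), ∃ a : ∀ n, G n → ℝ, ∀ n,
        AlmostInvariant (S n : Set (G n)) ε (a n) ∧ ∑ x, a n x ≤ M := by
    refine forall₂_congr fun ε hε => exists_congr fun M => and_congr_right fun _ => ?_
    refine (exists_almostInvariant_iff (S := fun n => (S n : Set (G n))) hε
      (fun _ f => ellNorm 1 f ≤ M)).trans ?_
    refine exists_congr fun a => forall_congr' fun n => and_congr_right fun ha => ?_
    rw [ellNorm_one_ofReal ha.nonneg]
  have h2 : (∀ ε > (0 : ℝ), ∃ M' > (0 : ℝ), ∃ f : ∀ n, G n → ℂ, ∀ n,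
        f n ∈ ellUnitNonneg 2 (G n) ∧
        (∀ s ∈ S n, ellNorm 2 (f n - rightTranslate s (f n)) ≤ ε) ∧
        ‖associatedOperator (f n)‖ ≤ M') ↔
      ∀ ε > (0 : ℝ), ∃ M > (0 : ℝ), ∃ a : ∀ n, G n → ℝ, ∀ n,
        AlmostInvariant (S n : Set (G n)) ε (a n) ∧ (∑ x, a n x) ^ 2 ≤ M := by
    refine forall₂_congr fun ε hε => exists_congr fun M => and_congr_right fun _ => ?_
    refine (exists_almostInvariant_iff (S := fun n => (S n : Set (G n))) hε
      (fun _ f => ‖associatedOperator f‖ ≤ M)).trans ?_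
    refine exists_congr fun a => forall_congr' fun n => and_congr_right fun ha => ?_
    rw [norm_associatedOperator_ofReal ha.nonneg]
  have h3 : (∀ ε > (0 : ℝ), ∃ N > (0 : ℕ), ∃ f : ∀ n, G n → ℂ, ∀ n,
        f n ∈ ellUnitNonneg 2 (G n) ∧
        (∀ s ∈ S n, ellNorm 2 (f n - rightTranslate s (f n)) ≤ ε) ∧
        (Function.support (f n)).ncard ≤ N) ↔
      ∀ ε > (0 : ℝ), ∃ N > (0 : ℕ), ∃ a : ∀ n, G n → ℝ, ∀ n,
        AlmostInvariant (S n : Set (G n)) ε (a n) ∧ (Function.support (a n)).ncard ≤ N := by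
    refine forall₂_congr fun ε hε => exists_congr fun N => and_congr_right fun _ => ?_
    refine (exists_almostInvariant_iff (S := fun n => (S n : Set (G n))) hε
      (fun _ f => (Function.support f).ncard ≤ N)).trans ?_
    simp_rw [hsupp]
  have h4 : UniformlyAmenable G (fun n => (S n : Set (G n))) ↔
      ∀ ε > (0 : ℝ), ∃ k : ℕ, ∃ a : ∀ n, G n → ℝ, ∀ n,
        AlmostInvariant (S n : Set (G n)) ε (a n) ∧
          ∀ g, a n g ≠ 0 → wordLength (S n : Set (G n)) g ≤ k := by
    refine forall₂_congr fun ε hε => ?_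
    have key : ∀ R : ℝ, _ := fun R =>
      exists_almostInvariant_iff (S := fun n => (S n : Set (G n))) hε
        (fun n f => Function.support f ⊆ {g | wordDist (S n : Set (G n)) 1 g ≤ R})
    simp only [hsupp, wordDist_one_left] at key
    simp only [wordDist_one_left, key]
    constructor
    · rintro ⟨R, hR, a, ha⟩
      exact ⟨⌊R⌋₊, a, fun n => ⟨(ha n).1, fun g hg => Nat.le_floor ((ha n).2 hg)⟩⟩
    · rintro ⟨k, a, ha⟩
      refine ⟨k + 1, by positivity, a, fun n => ⟨(ha n).1, fun g hg => ?_⟩⟩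
      exact_mod_cast ((ha n).2 g hg).trans (Nat.le_succ k)
  rw [h1, h2, h3, h4]
  tfae_have 1 → 2 := fun H ε hε => by
    obtain ⟨M, hM, a, ha⟩ := H ε hε
    refine ⟨M ^ 2, by positivity, a, fun n => ⟨(ha n).1, ?_⟩⟩
    exact pow_le_pow_left₀ (Finset.sum_nonneg fun x _ => (ha n).1.nonneg x) (ha n).2 2
  tfae_have 2 → 1 := fun H ε hε => by
    obtain ⟨M, hM, a, ha⟩ := H ε hε
    exact ⟨√M, Real.sqrt_pos.2 hM, a, fun n => ⟨(ha n).1, Real.le_sqrt_of_sq_le (ha n).2⟩⟩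
  tfae_have 1 → 3 := fun H ε hε => by
    obtain ⟨M, hM, a, ha⟩ := H (ε / 4) (by positivity)
    have hδ : min (1 / 2) (ε ^ 2 / 24) / M * M = min (1 / 2) (ε ^ 2 / 24) := by field_simp
    have hδ0 : 0 < min (1 / 2) (ε ^ 2 / 24) / M := by positivity
    choose b hb using fun n => (ha n).1.exists_ncard_support_le (ha n).2 hδ0
      (hδ.trans_le (min_le_left _ _)) (hδ.trans_le (min_le_right _ _))
    refine ⟨⌊M / (min (1 / 2) (ε ^ 2 / 24) / M)⌋₊ + 1, Nat.succ_pos _, b, fun n => ⟨(hb n).1, ?_⟩⟩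
    exact (Nat.le_floor (hb n).2).trans (Nat.le_succ _)
  tfae_have 3 → 4 := fun H ε hε => by
    -- `L + 1` rather than `L` keeps the divisor positive when `L = 0`.
    obtain ⟨N, -, a, ha⟩ := H (ε / √(L + 1)) (by positivity)
    have hL' : (L : ℝ) * (ε / √(L + 1)) ^ 2 ≤ ε ^ 2 := by
      rw [div_pow, Real.sq_sqrt (by positivity), ← mul_div_assoc, div_le_iff₀ (by positivity)]
      nlinarith [sq_nonneg ε]
    choose b hb using fun n => (ha n).1.exists_support_subset (hS n) (hL n) hL'
    exact ⟨N, b, fun n => ⟨(hb n).1, fun g hg => ((hb n).2 g hg).trans (ha n).2⟩⟩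
  tfae_have 4 → 3 := fun H ε hε => by
    obtain ⟨k, a, ha⟩ := H ε hε
    refine ⟨(2 * L + 1) ^ k, by positivity, a, fun n => ⟨(ha n).1, ?_⟩⟩
    exact (Set.ncard_le_ncard (ha n).2 (Set.toFinite _)).trans (ncard_wordLength_le (hS n) (hL n) k)
  tfae_have 3 → 1 := fun H ε hε => by
    obtain ⟨N, hN, a, ha⟩ := H ε hε
    exact ⟨N, by exact_mod_cast hN, a, fun n => ⟨(ha n).1, (ha n).1.sum_le (ha n).2⟩⟩
  tfae_have 4 → 5 := propertyA_of_almostInvariant hL hD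
  tfae_have 5 → 4 := fun H ε hε => exists_almostInvariant_of_propertyA hD H hε
  tfae_finish
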